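/- Let $1\le r<n$ be integers, let $\mathfrak{C}_n=\{0,\dots,n-1\}^{\mathbb N}$, let $\dot{\mathbf r}=\{\dot 0,\dots,\dot{r-1}\}$ be a disjoint set of $r$ letters, and let $\mathfrak{C}_{n,r}=\dot{\mathbf r}\times\mathfrak{C}_n$ (product topology). Let $W_{n,\varepsilon}$ be the set of finite (possibly empty) words over $\{0,\dots,n-1\}$ and $W_{n,r,\varepsilon}=\dot{\mathbf r}\times W_{n,\varepsilon}$; for $\nu\in W_{n,r,\varepsilon}$ let $U_\nu=\{\nu x: x\in\mathfrak{C}_n\}$. The Higman group $G_{n,r}$ is the group of homeomorphisms $g$ of $\mathfrak{C}_{n,r}$ for which there are finite maximal antichains $(\eta_i)_{i<k}$, $(\zeta_i)_{i<k}$ of the same length in $W_{n,r,\varepsilon}$ (ordered by "is a prefix of") such that $g$ maps $\eta_i x$ to $\zeta_i x$ for all $i<k$ and $x\in\mathfrak{C}_n$. Maps act on the right, so $h^{-1}gh$ means: first $h^{-1}$, then $g$, then $h$. For a homeomorphism $h$ of $\mathfrak{C}_{n,r}$ and $\nu\in W_{n,r,\varepsilon}$ let $\theta_h(\nu)$ be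 the longest common prefix of the points of $U_\nu h$ (as sequences over $\dot{\mathbf r}\sqcup\{0,\dots,n-1\}$; it may be empty). The local action $h_\nu$ is the map on $\mathfrak{C}_n$, with values in $\mathfrak{C}_n$, or in $\mathfrak{C}_{n,r}$ if $\theta_h(\nu)$ is empty, that sends $x$ to the $y$ with $(\nu x)h=\theta_h(\nu)\,y$. A (non-degenerate, initial) transducer for $\mathfrak{C}_{n,r}$ has a countable state set $R\sqcup S$ with $R$ finite, an initial state $q_0\in R$, and transition and output functions $\pi,\lambda$ defined on pairs (letter, state), where $q_0$ reads letters of $\dot{\mathbf r}$ and the other states read letters of $\{0,\dots,n-1\}$; no transition leads to $q_0$, and outputs are finite words. A transition into $R$ starts in $R$ and has empty output; a transition from $R$ into $S$ has output in $W_{n,r,\varepsilon}$; a transition from a state in $S$ leads to $S$ and has output in $W_{n,\varepsilon}$; reading a non-empty word along a closed path yields non-empty output; from a state in $S$ every infinite input gives an infinite output. It represents $h$ if from $q_0$ it transforms every input $p\in\mathfrak{C}_{n,r}$ into the output $ph$. It is minimal if every state is reached from $q_0$ by some word, distinct states other than $q_0$ induce distinct maps on infinite sequences, and, for every $\nu\in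 W_{n,r,\varepsilon}$, the output on $\nu$ from $q_0$ is not a proper prefix of the longest common prefix of the outputs on all points of $U_\nu$. Let $\mathcal{R}_{n,r}$ be the set of homeomorphisms of $\mathfrak{C}_{n,r}$ that are represented by a minimal transducer with finitely many states. **Theorem.** Let $h$ be a homeomorphism of $\mathfrak{C}_{n,r}$ with $h^{-1}G_{n,r}h\subseteq G_{n,r}$. Then the set $\{h_\nu : \nu\in W_{n,r,\varepsilon}\}$ of local actions of $h$ is finite, and $h\in\mathcal{R}_{n,r}$; that is, $h$ is represented by a finite minimal transducer. In particular, both conclusions hold if $h$ is a Rubin conjugator of an automorphism $\phi$ of $G_{n,r}$, i.e. if $\phi(g)=h^{-1}gh$ for all $g\in G_{n,r}$. -/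

import Mathlib

namespace HigmanThompson

/-! ## Words, points and cones -/

/-- The Cantor space of all infinite sequences over the alphabet `{0, …, n - 1}`
(product topology). -/
abbrev Cantor (n : ℕ) : Type := ℕ → Fin n

/-- The Cantor space `𝔠_{n,r}`: a first letter from an alphabet of `r` dotted letters, followed by
an infinite sequence over `{0, …, n - 1}` (product topology). -/
abbrev CantorR (n r : ℕ) : Type := Fin r × Cantor n

/-- The words `W_{n,r,ε}`: a dotted letter followed by a (possibly empty) finite word. -/
abbrev Word (n r : ℕ) : Type := Fin r × List (Fin n)

/-- Concatenation of a finite word with an infinite sequence. -/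
def cat {α : Type} (w : List α) (x : ℕ → α) : ℕ → α :=
  fun i => if h : i < w.length then w[i] else x (i - w.length)

/-- The point `ν ⌢ x` of `𝔠_{n,r}`, for `ν ∈ W_{n,r,ε}` and `x ∈ 𝔠_n`. -/
def Word.cat {n r : ℕ} (ν : Word n r) (x : Cantor n) : CantorR n r :=
  (ν.1, HigmanThompson.cat ν.2 x)

/-- `ν ≤ η`: the word `ν` is a prefix of `η`. -/
def Word.IsPrefix {n r : ℕ} (ν η : Word n r) : Prop := ν.1 = η.1 ∧ ν.2 <+: η.2

/-! ## The Higman groups -/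

/-- A finite family of words that is a maximal antichain for the prefix order. -/
def IsMaximalAntichain {n r k : ℕ} (η : Fin k → Word n r) : Prop :=
  (∀ i j, i ≠ j → ¬ (η i).IsPrefix (η j)) ∧
    ∀ ζ : Word n r, ∃ i, (η i).IsPrefix ζ ∨ ζ.IsPrefix (η i)

/-- `g` is a prefix code map: there are maximal antichains `η`, `ζ` of the same length such that
`g` replaces the prefix `η i` by the prefix `ζ i`, for every `i`. -/
def IsPrefixCodeMap {n r : ℕ} (g : CantorR n r ≃ₜ CantorR n r) : Prop :=
  ∃ (k : ℕ) (η ζ : Fin k → Word n r), IsMaximalAntichain η ∧ IsMaximalAntichain ζ ∧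
    ∀ i x, g ((η i).cat x) = (ζ i).cat x

theorem cat_append {α : Type} (u v : List α) (x : ℕ → α) : cat (u ++ v) x = cat u (cat v x) := by
  funext i
  simp only [cat, List.length_append]
  by_cases h : i < u.length
  · have h' : i < u.length + v.length := by omega
    simp [h, h', List.getElem_append_left]
  · by_cases h' : i < u.length + v.length
    · have h2 : i - u.length < v.length := by omega
      simp [h, h', h2, List.getElem_append_right (Nat.le_of_not_lt h)]
    · have h2 : ¬ i - u.length < v.length := by omega
      simp [h, h', h2, Nat.sub_sub]

theorem prefix_of_cat_eq {α : Type} {u v : List α} {x y : ℕ → α} (h : cat u x = cat v y)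
    (hl : u.length ≤ v.length) : u <+: v := by
  rw [List.prefix_iff_getElem]
  refine ⟨hl, fun i hi => ?_⟩
  have := congrFun h i
  have hv : i < v.length := lt_of_lt_of_le hi hl
  simpa [cat, hi, hv] using this

theorem cat_injective {α : Type} (u : List α) : Function.Injective (cat u) := by
  intro x y h
  funext i
  have := congrFun h (u.length + i)
  simpa [cat] using this

theorem Word.cat_injective {n r : ℕ} (ν : Word n r) : Function.Injective ν.cat := by
  intro x y h
  exact HigmanThompson.cat_injective ν.2 (congrArg Prod.snd h)

theorem Word.exists_cat {n r : ℕ} {ν η : Word n r} (h : ν.IsPrefix η) (x : Cantor n) :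
    ∃ y, η.cat x = ν.cat y := by
  obtain ⟨h1, t, h2⟩ := h
  refine ⟨HigmanThompson.cat t x, ?_⟩
  simp only [Word.cat]
  rw [← h2, cat_append, h1]

theorem Word.comparable {n r : ℕ} {ν η : Word n r} {x y : Cantor n} (h : ν.cat x = η.cat y) :
    ν.IsPrefix η ∨ η.IsPrefix ν := by
  have h1 : ν.1 = η.1 := (Prod.ext_iff.1 h).1
  have h2 : HigmanThompson.cat ν.2 x = HigmanThompson.cat η.2 y := (Prod.ext_iff.1 h).2
  rcases le_total ν.2.length η.2.length with hl | hl
  · exact Or.inl ⟨h1, prefix_of_cat_eq h2 hl⟩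
  · exact Or.inr ⟨h1.symm, prefix_of_cat_eq h2.symm hl⟩

/-- The cones of a maximal antichain partition `𝔠_{n,r}`. -/
theorem IsMaximalAntichain.existsUnique {n r k : ℕ} {η : Fin k → Word n r}
    (h : IsMaximalAntichain η) (p : CantorR n r) : ∃! i, ∃ x, p = (η i).cat x := by
  set N := Finset.univ.sup (fun i => (η i).2.length) with hN
  have hle : ∀ i, (η i).2.length ≤ N := fun i =>
    Finset.le_sup (f := fun i => (η i).2.length) (Finset.mem_univ i)
  let ζ : Word n r := (p.1, List.ofFn (fun i : Fin N => p.2 i))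
  have hp : p = ζ.cat (fun i => p.2 (i + N)) := by
    refine Prod.ext rfl ?_
    funext i
    by_cases hi : i < N
    · simp [Word.cat, HigmanThompson.cat, ζ, hi]
    · simp [Word.cat, HigmanThompson.cat, ζ, hi, Nat.sub_add_cancel (Nat.le_of_not_lt hi)]
  obtain ⟨i, hi⟩ := h.2 ζ
  have hi' : (η i).IsPrefix ζ := by
    rcases hi with hi | hi
    · exact hi
    · have hlen : ζ.2.length = N := by simp [ζ]
      have := hi.2.eq_of_length_le (by rw [hlen]; exact hle i)
      exact ⟨hi.1.symm, by rw [this]⟩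
  refine ⟨i, ?_, ?_⟩
  · obtain ⟨y, hy⟩ := Word.exists_cat hi' (fun i => p.2 (i + N))
    exact ⟨y, hp.trans hy⟩
  · rintro j ⟨x, hx⟩
    obtain ⟨y, hy⟩ := Word.exists_cat hi' (fun i => p.2 (i + N))
    by_contra hij
    rcases Word.comparable (hx.symm.trans (hp.trans hy)) with hc | hc
    · exact h.1 _ _ hij hc
    · exact h.1 _ _ (Ne.symm hij) hc

/-- A finite family of words whose cones partition `𝔠_{n,r}` is a maximal antichain. -/
theorem isMaximalAntichain_of_existsUnique {n r k : ℕ} (hn : 0 < n) {η : Fin k → Word n r}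
    (h : ∀ p, ∃! i, ∃ x, p = (η i).cat x) : IsMaximalAntichain η := by
  let z : Cantor n := fun _ => ⟨0, hn⟩
  refine ⟨fun i j hij hc => ?_, fun ζ => ?_⟩
  · obtain ⟨y, hy⟩ := Word.exists_cat hc z
    exact hij ((h ((η j).cat z)).unique ⟨y, hy⟩ ⟨z, rfl⟩)
  · obtain ⟨i, ⟨x, hx⟩, -⟩ := h (ζ.cat z)
    exact ⟨i, (Word.comparable hx).symm⟩

theorem isPrefixCodeMap_one (n r : ℕ) : IsPrefixCodeMap (1 : CantorR n r ≃ₜ CantorR n r) := by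
  have h : IsMaximalAntichain (fun a : Fin r => ((a, []) : Word n r)) :=
    ⟨fun i j hij hc => hij hc.1, fun ζ => ⟨ζ.1, Or.inl ⟨rfl, List.nil_prefix⟩⟩⟩
  exact ⟨r, _, _, h, h, fun i x => rfl⟩

theorem IsPrefixCodeMap.inv {n r : ℕ} {g : CantorR n r ≃ₜ CantorR n r} (h : IsPrefixCodeMap g) :
    IsPrefixCodeMap g⁻¹ := by
  obtain ⟨k, η, ζ, h1, h2, h3⟩ := h
  refine ⟨k, ζ, η, h2, h1, fun i x => ?_⟩
  rw [← h3 i x]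
  exact g.symm_apply_apply _

theorem append_drop_eq {α : Type} {u v : List α} (h : u <+: v ∨ v <+: u) :
    u ++ v.drop u.length = v ++ u.drop v.length := by
  rcases h with ⟨t, rfl⟩ | ⟨t, rfl⟩ <;> simp

theorem IsPrefixCodeMap.mul {n r : ℕ} {f g : CantorR n r ≃ₜ CantorR n r}
    (hf : IsPrefixCodeMap f) (hg : IsPrefixCodeMap g) : IsPrefixCodeMap (f * g) := by
  classical
  obtain ⟨k, η, ζ, h1, h2, h3⟩ := hg
  obtain ⟨k', η', ζ', h1', h2', h3'⟩ := hf
  rcases Nat.eq_zero_or_pos n with hn | hn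
  · subst hn
    exact ⟨k, η, ζ, h1, h2, fun i x => (x 0).elim0⟩
  let ι := {p : Fin k × Fin k' // (ζ p.1).IsPrefix (η' p.2) ∨ (η' p.2).IsPrefix (ζ p.1)}
  let e : ι ≃ Fin (Fintype.card ι) := Fintype.equivFin ι
  let src : ι → Word n r := fun p =>
    ((η p.1.1).1, (η p.1.1).2 ++ (η' p.1.2).2.drop (ζ p.1.1).2.length)
  let tgt : ι → Word n r := fun p =>
    ((ζ' p.1.2).1, (ζ' p.1.2).2 ++ (ζ p.1.1).2.drop (η' p.1.2).2.length)
  have hsrc : ∀ p x, (src p).cat x =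
      (η p.1.1).cat (cat ((η' p.1.2).2.drop (ζ p.1.1).2.length) x) := fun p x => by
    simp only [src, Word.cat, cat_append]
  have hmid : ∀ p : ι, ∀ x,
      (ζ p.1.1).cat (cat ((η' p.1.2).2.drop (ζ p.1.1).2.length) x) =
      (η' p.1.2).cat (cat ((ζ p.1.1).2.drop (η' p.1.2).2.length) x) := fun p x => by
    have ha : (ζ p.1.1).1 = (η' p.1.2).1 := p.2.elim (fun h => h.1) (fun h => h.1.symm)
    have hb := append_drop_eq (p.2.imp (fun h => h.2) (fun h => h.2))
    simp only [Word.cat, ← cat_append]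
    rw [ha, hb]
  have hmap : ∀ p x, (f * g) ((src p).cat x) = (tgt p).cat x := fun p x => by
    change f (g _) = _
    rw [hsrc, h3, hmid, h3']
    simp only [tgt, Word.cat, cat_append]
  have hpart : ∀ p, ∃! i, ∃ x, p = (src i).cat x := fun p => by
    obtain ⟨i, ⟨x, hx⟩, hi⟩ := h1.existsUnique p
    obtain ⟨j, ⟨y, hy⟩, hj⟩ := h1'.existsUnique (g p)
    have hxy : (ζ i).cat x = (η' j).cat y := by rw [← hy, hx, h3]
    let q : ι := ⟨(i, j), Word.comparable hxy⟩
    refine ⟨q, ?_, ?_⟩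
    · have hm : ∃ z, x = cat ((η' j).2.drop (ζ i).2.length) z := by
        rcases Word.comparable hxy with hc | hc
        · obtain ⟨t, ht⟩ := hc.2
          refine ⟨y, ?_⟩
          apply (ζ i).cat_injective
          rw [hxy]
          simp only [Word.cat, ← cat_append]
          rw [← ht, hc.1]
          simp
        · refine ⟨x, ?_⟩
          rw [List.drop_eq_nil_of_le hc.2.length_le]
          funext i
          simp [HigmanThompson.cat]
      obtain ⟨z, hz⟩ := hm
      refine ⟨z, ?_⟩
      rw [hsrc, hx]
      exact congrArg _ hz
    · rintro ⟨⟨i', j'⟩, hc⟩ ⟨z, hz⟩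
      have hii : i' = i := hi i' ⟨_, hz.trans (hsrc _ z)⟩
      have hjj : j' = j := by
        refine hj j' ⟨cat ((ζ i').2.drop (η' j').2.length) z, ?_⟩
        rw [hz, hsrc, h3]
        exact hmid ⟨(i', j'), hc⟩ z
      subst hii hjj
      rfl
  have hpart' : ∀ p, ∃! i, ∃ x, p = (tgt i).cat x := fun p => by
    have hiff : ∀ i, (∃ x, p = (tgt i).cat x) ↔ ∃ x, (f * g).symm p = (src i).cat x := fun i => by
      refine exists_congr fun x => ?_
      rw [Homeomorph.symm_apply_eq, hmap]
    simp only [hiff]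
    exact hpart _
  have htrans : ∀ w : ι → Word n r, (∀ p, ∃! i, ∃ x, p = (w i).cat x) →
      IsMaximalAntichain (fun i => w (e.symm i)) := fun w hw => by
    refine isMaximalAntichain_of_existsUnique hn fun p => ?_
    obtain ⟨i, hi, hu⟩ := hw p
    refine ⟨e i, by simpa using hi, fun j hj => ?_⟩
    rw [← hu _ hj, e.apply_symm_apply]
  exact ⟨_, fun i => src (e.symm i), fun i => tgt (e.symm i), htrans _ hpart, htrans _ hpart',
    fun i x => hmap _ x⟩

/-- The Higman group `G_{n,r}`: the group of all prefix code maps of `𝔠_{n,r}`. -/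
def higmanGroup (n r : ℕ) : Subgroup (CantorR n r ≃ₜ CantorR n r) where
  carrier := {g | IsPrefixCodeMap g}
  mul_mem' := IsPrefixCodeMap.mul
  one_mem' := isPrefixCodeMap_one n r
  inv_mem' := IsPrefixCodeMap.inv

/-- The conjugate `h⁻¹ g h` for right actions, i.e. first `h⁻¹`, then `g`, then `h`. -/
def conjugate {n r : ℕ} (h g : CantorR n r ≃ₜ CantorR n r) : CantorR n r ≃ₜ CantorR n r :=
  (h.symm.trans g).trans h

/-- `h` is a Rubin conjugator of the automorphism `φ` of `G_{n,r}`: `φ` is `g ↦ h⁻¹ g h`. -/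
def IsRubinConjugator {n r : ℕ} (φ : MulAut (higmanGroup n r))
    (h : CantorR n r ≃ₜ CantorR n r) : Prop :=
  ∀ g : higmanGroup n r, (φ g : CantorR n r ≃ₜ CantorR n r) = conjugate h g

/-! ## Local actions

The points of `𝔠_{n,r}` and of `𝔠_n` are both regarded as infinite sequences over the disjoint union
of the two alphabets. -/

/-- The disjoint union of the dotted alphabet and of `{0, …, n - 1}`. -/
abbrev Letter (n r : ℕ) : Type := Fin r ⊕ Fin n

/-- A point of `𝔠_n` as a sequence over the joint alphabet. -/
def Cantor.toSeq {n : ℕ} (r : ℕ) (x : Cantor n) : ℕ → Letter n r := fun i => Sum.inr (x i)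

/-- A point of `𝔠_{n,r}` as a sequence over the joint alphabet. -/
def CantorR.toSeq {n r : ℕ} (p : CantorR n r) : ℕ → Letter n r :=
  cat [Sum.inl p.1] (Cantor.toSeq r p.2)

/-- `w` is a prefix of the infinite sequence `y`. -/
def IsPrefixOf {α : Type} (w : List α) (y : ℕ → α) : Prop := ∃ z, y = cat w z

/-- `w` is the longest common prefix of the sequences in `S`. -/
def IsLongestCommonPrefix {α : Type} (S : Set (ℕ → α)) (w : List α) : Prop :=
  (∀ y ∈ S, IsPrefixOf w y) ∧ ∀ v : List α, (∀ y ∈ S, IsPrefixOf v y) → v <+: w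

theorem IsLongestCommonPrefix.unique {α : Type} {S : Set (ℕ → α)} {v w : List α}
    (hv : IsLongestCommonPrefix S v) (hw : IsLongestCommonPrefix S w) : v = w :=
  (hw.2 v hv.1).eq_of_length_le (hv.2 w hw.1).length_le

theorem exists_isLongestCommonPrefix {α : Type} {S : Set (ℕ → α)} (hS : S.Nontrivial) :
    ∃ w, IsLongestCommonPrefix S w := by
  classical
  obtain ⟨y, hy, z, hz, hne⟩ := hS
  obtain ⟨m, hm⟩ : ∃ m, y m ≠ z m := Function.ne_iff.1 hne
  have hbound : ∀ v : List α, (∀ y ∈ S, IsPrefixOf v y) → v.length ≤ m := fun v hv => by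
    by_contra hlt
    obtain ⟨y', hy'⟩ := hv y hy
    obtain ⟨z', hz'⟩ := hv z hz
    apply hm
    rw [hy', hz']
    simp [cat, not_le.1 hlt]
  let P : ℕ → Prop := fun l => ∃ v : List α, v.length = l ∧ ∀ y ∈ S, IsPrefixOf v y
  have h0 : P 0 := ⟨[], rfl, fun y _ => ⟨y, by funext i; simp [cat]⟩⟩
  obtain ⟨w, hwl, hw⟩ := Nat.findGreatest_spec (P := P) (Nat.zero_le m) h0
  refine ⟨w, hw, fun v hv => ?_⟩
  have hle : v.length ≤ w.length := by
    rw [hwl]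
    exact Nat.le_findGreatest (hbound v hv) ⟨v, rfl, hv⟩
  obtain ⟨y1, h1⟩ := hv y hy
  obtain ⟨y2, h2⟩ := hw y hy
  exact prefix_of_cat_eq (h1.symm.trans h2) hle

open Classical in
/-- The root of a set of sequences: its longest common prefix. (A set with at least two points has
one; otherwise the value is irrelevant.) -/
noncomputable def root {α : Type} (S : Set (ℕ → α)) : List α :=
  if h : ∃ w, IsLongestCommonPrefix S w then h.choose else []

/-- The root function `θ_h`: the root of the image under `h` of the cone of `ν`. -/
noncomputable def rootFun {n r : ℕ} (h : CantorR n r ≃ₜ CantorR n r) (ν : Word n r) :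
    List (Letter n r) :=
  root (Set.range fun x : Cantor n => (h (ν.cat x)).toSeq)

/-- The local action `h_ν` of `h` at `ν`: it sends `x` to the `y` with `h (ν ⌢ x) = θ_h(ν) ⌢ y`.
If all points of the image of the cone of `ν` have the same first letter, `h_ν` takes its values in
`𝔠_n`; otherwise `θ_h(ν)` is empty and `h_ν` takes its values in `𝔠_{n,r}`. -/
noncomputable def localAction {n r : ℕ} (h : CantorR n r ≃ₜ CantorR n r) (ν : Word n r) :
    Cantor n → (ℕ → Letter n r) :=
  fun x i => (h (ν.cat x)).toSeq ((rootFun h ν).length + i)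

/-! ## Transducers for `𝔠_{n,r}` and the rational group -/

/-- Extended transition function of an automaton reading a finite word. -/
def runState {n : ℕ} {Q : Type} (π : Fin n → Q → Q) : List (Fin n) → Q → Q
  | [], q => q
  | x :: w, q => runState π w (π x q)

/-- Extended output function of an automaton reading a finite word. -/
def runOut {n : ℕ} {Q α : Type} (π : Fin n → Q → Q) (out : Fin n → Q → List α) :
    List (Fin n) → Q → List α
  | [], _ => []
  | x :: w, q => out x q ++ runOut π out w (π x q)

/-- The infinite output produced from the state `q` on the infinite input `x` is `y`: the outputs
on the finite prefixes of `x` are prefixes of `y` of unbounded length. -/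
def Produces {n : ℕ} {Q α : Type} (π : Fin n → Q → Q) (out : Fin n → Q → List α)
    (q : Q) (x : Cantor n) (y : ℕ → α) : Prop :=
  (∀ k : ℕ, IsPrefixOf (runOut π out (List.ofFn fun i : Fin k => x i) q) y) ∧
    ∀ N : ℕ, ∃ k : ℕ, N ≤ (runOut π out (List.ofFn fun i : Fin k => x i) q).length

/-- The output word `w` lies in `W_{n,r,ε}`. -/
def IsDottedWord {n r : ℕ} (w : List (Letter n r)) : Prop :=
  ∃ (a : Fin r) (u : List (Fin n)), w = Sum.inl a :: u.map Sum.inr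

/-- The output word `w` lies in `W_{n,ε}`. -/
def IsPlainWord {n r : ℕ} (w : List (Letter n r)) : Prop :=
  ∃ u : List (Fin n), w = u.map Sum.inr

/-- A non-degenerate initial transducer for `𝔠_{n,r}`. The initial state `q₀` reads a dotted letter,
is never re-entered, and is not an element of `Q`; the set of all states is `Q ∪ {q₀}`. The states in
`R ∪ {q₀}` are those reached before anything has been written; the others form the set `S`. -/
structure Transducer (n r : ℕ) where
  /-- The states other than the initial state. -/
  Q : Type
  /-- The states, other than the initial one, that belong to the part `R`. -/
  R : Set Q
  /-- Transitions from the initial state. -/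
  π₀ : Fin r → Q
  /-- Output of the initial state. -/
  out₀ : Fin r → List (Letter n r)
  /-- Transitions from the other states. -/
  π : Fin n → Q → Q
  /-- Output of the other states. -/
  out : Fin n → Q → List (Letter n r)
  finite_R : R.Finite
  countable_Q : Countable Q
  init_to_R : ∀ a, π₀ a ∈ R → out₀ a = []
  to_R : ∀ x q, π x q ∈ R → q ∈ R ∧ out x q = []
  init_to_S : ∀ a, π₀ a ∉ R → IsDottedWord (out₀ a)
  R_to_S : ∀ x q, q ∈ R → π x q ∉ R → IsDottedWord (out x q)
  S_to_S : ∀ x q, q ∉ R → IsPlainWord (out x q) ∧ π x q ∉ R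
  cycle : ∀ q w, w ≠ [] → runState π w q = q → runOut π out w q ≠ []
  infinite_output : ∀ q, q ∉ R → ∀ x : Cantor n, ∃ y : Cantor n,
    Produces π out q x (Cantor.toSeq r y)

namespace Transducer

variable {n r : ℕ}

/-- The transducer has finitely many states. -/
def IsFinite (A : Transducer n r) : Prop := Finite A.Q

/-- The state reached from the initial state on reading `ν ∈ W_{n,r,ε}`. -/
def stateAt (A : Transducer n r) (ν : Word n r) : A.Q := runState A.π ν.2 (A.π₀ ν.1)

/-- The output written from the initial state on reading `ν ∈ W_{n,r,ε}`. -/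
def outAt (A : Transducer n r) (ν : Word n r) : List (Letter n r) :=
  A.out₀ ν.1 ++ runOut A.π A.out ν.2 (A.π₀ ν.1)

/-- From its initial state, on the input `p`, the transducer writes the infinite sequence `y`. -/
def Writes (A : Transducer n r) (p : CantorR n r) (y : ℕ → Letter n r) : Prop :=
  ∃ z, Produces A.π A.out (A.π₀ p.1) p.2 z ∧ y = cat (A.out₀ p.1) z

/-- The transducer represents `h`. -/
def Represents (A : Transducer n r) (h : CantorR n r ≃ₜ CantorR n r) : Prop :=
  ∀ p, A.Writes p (h p).toSeq

/-- Every state is reached from the initial state. -/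
def IsAccessible (A : Transducer n r) : Prop := ∀ q, ∃ ν, A.stateAt ν = q

/-- `q` is a state of incomplete response: for some `ν` leading from the initial state to `q`, the
output on `ν` is a proper prefix of the root of the image of the cone of `ν` under the map that
the transducer induces. -/
def IsIncompleteResponse (A : Transducer n r) (q : A.Q) : Prop :=
  ∃ ν, A.stateAt ν = q ∧
    A.outAt ν <+: root {y | ∃ x, A.Writes (ν.cat x) y} ∧
    A.outAt ν ≠ root {y | ∃ x, A.Writes (ν.cat x) y}

/-- Two states are equivalent if they induce the same map on infinite sequences. -/
def Equivalent (A : Transducer n r) (q₁ q₂ : A.Q) : Prop :=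
  ∀ x y, Produces A.π A.out q₁ x y ↔ Produces A.π A.out q₂ x y

/-- The transducer is minimal: all states are accessible, there is no state of incomplete response,
and equivalent states are equal. -/
def IsMinimal (A : Transducer n r) : Prop :=
  A.IsAccessible ∧ (∀ q, ¬ A.IsIncompleteResponse q) ∧ ∀ q₁ q₂, A.Equivalent q₁ q₂ → q₁ = q₂

end Transducer

/-- `𝓡_{n,r}`: the homeomorphisms of `𝔠_{n,r}` that are represented by a finite minimal
(non-degenerate, initial) transducer. -/
def rationalGroup (n r : ℕ) : Set (CantorR n r ≃ₜ CantorR n r) :=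
  {h | ∃ A : Transducer n r, A.IsFinite ∧ A.IsMinimal ∧ A.Represents h}

end HigmanThompson

/-!
Removing the longest common prefix from `x ↦ h (ν ⌢ x)` gives the local action `h_ν`, and the local
action at `ν ⌢ w` depends only on `h_ν` and `w` (`localAction_append`).

Suppose `g ∈ G_{n,r}` replaces the prefix `ν` by `η`. The conjugate of `g` by `h` carries
`h (ν ⌢ x)` to `h (η ⌢ x)`. If it is again a prefix code map, then it only changes a prefix on each
of finitely many cones, and by compactness the cone of `ν ⌢ w` is mapped by `h` into one of these
cones as soon as `w` is long. Since changing a common prefix does not affect the reduced map,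
`h_{ν ⌢ w} = h_{η ⌢ w}` for all long `w` (`exists_forall_localAction_append_eq`).

The group `G_{n,r}` contains an element replacing `a b c` by the shorter word `a d`, for any `d ≠ b`
(`exists_mem_higmanGroup_cat_eq`). There are finitely many triples `a, b, c`, so there is a uniform
bound beyond which every word has the local action of a word with one letter less, and only finitely
many local actions remain (`finite_range_localAction`).

A finite set of local actions is the state set of a transducer for `h`: reading the letter `x` in
the state `h_ν` leads to `h_{ν ⌢ x}` and writes what the root at `ν ⌢ x` adds to the root at `ν`.
The word written along `ν` is therefore the root at `ν`, so no response is incomplete, and the state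
`h_ν` induces the map `h_ν`, so distinct states are inequivalent (`actionTransducer_isMinimal`).
-/

namespace HigmanThompson

/-! ### Infinite sequences and their prefixes -/

section Sequences

variable {α : Type}

theorem cat_nil (x : ℕ → α) : cat [] x = x := by
  funext i
  simp [cat]

/-- The sequence obtained by deleting the first `k` letters. -/
def dropSeq (k : ℕ) (y : ℕ → α) : ℕ → α := fun i => y (k + i)

/-- The word formed by the first `k` letters. -/
def takeSeq (k : ℕ) (y : ℕ → α) : List α := List.ofFn fun i : Fin k => y i

@[simp]
theorem length_takeSeq (k : ℕ) (y : ℕ → α) : (takeSeq k y).length = k := by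
  simp [takeSeq]

theorem dropSeq_length_cat (w : List α) (y : ℕ → α) : dropSeq w.length (cat w y) = y := by
  funext i
  simp [dropSeq, cat]

theorem dropSeq_dropSeq (a b : ℕ) (y : ℕ → α) : dropSeq b (dropSeq a y) = dropSeq (a + b) y := by
  funext i
  simp [dropSeq, Nat.add_assoc]

theorem cat_takeSeq_apply {k i : ℕ} (h : i < k) (x z : ℕ → α) : cat (takeSeq k x) z i = x i := by
  simp [cat, takeSeq, h]

theorem cat_takeSeq_dropSeq (k : ℕ) (y : ℕ → α) : cat (takeSeq k y) (dropSeq k y) = y := by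
  funext i
  by_cases h : i < k
  · exact cat_takeSeq_apply h _ _
  · simp [cat, dropSeq, h, Nat.add_sub_cancel' (Nat.le_of_not_lt h)]

theorem isPrefixOf_cat (w : List α) (y : ℕ → α) : IsPrefixOf w (cat w y) := ⟨y, rfl⟩

theorem isPrefixOf_takeSeq (k : ℕ) (y : ℕ → α) : IsPrefixOf (takeSeq k y) y :=
  ⟨_, (cat_takeSeq_dropSeq k y).symm⟩

theorem IsPrefixOf.cat_dropSeq {w : List α} {y : ℕ → α} (h : IsPrefixOf w y) :
    cat w (dropSeq w.length y) = y := by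
  obtain ⟨z, rfl⟩ := h
  rw [dropSeq_length_cat]

theorem isPrefixOf_append_cat {u v : List α} {y : ℕ → α} :
    IsPrefixOf (u ++ v) (cat u y) ↔ IsPrefixOf v y := by
  constructor
  · rintro ⟨z, hz⟩
    rw [cat_append] at hz
    exact ⟨z, cat_injective u hz⟩
  · rintro ⟨z, rfl⟩
    exact ⟨z, (cat_append _ _ _).symm⟩

theorem IsPrefixOf.prefix {u v : List α} {y : ℕ → α} (hu : IsPrefixOf u y) (hv : IsPrefixOf v y)
    (hl : u.length ≤ v.length) : u <+: v := by
  obtain ⟨a, ha⟩ := hu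
  obtain ⟨b, hb⟩ := hv
  exact prefix_of_cat_eq (ha.symm.trans hb) hl

theorem isPrefixOf_iff_forall {w : List α} {y : ℕ → α} :
    IsPrefixOf w y ↔ ∀ i : Fin w.length, y i = w[i] := by
  constructor
  · rintro ⟨z, rfl⟩ i
    simp [cat]
  · intro h
    refine ⟨dropSeq w.length y, ?_⟩
    funext i
    by_cases hi : i < w.length
    · simpa [cat, hi] using h ⟨i, hi⟩
    · simp [cat, dropSeq, hi, Nat.add_sub_cancel' (Nat.le_of_not_lt hi)]

/-! ### Roots and reduced maps -/

theorem root_spec {S : Set (ℕ → α)} (hS : S.Nontrivial) : IsLongestCommonPrefix S (root S) := by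
  have h := exists_isLongestCommonPrefix hS
  rw [root, dif_pos h]
  exact h.choose_spec

theorem root_image_cat (A : List α) {Y : Set (ℕ → α)} (hY : Y.Nontrivial) :
    root (cat A '' Y) = A ++ root Y := by
  have hn : (cat A '' Y).Nontrivial := hY.image (cat_injective A)
  obtain ⟨t, ht⟩ : A <+: root (cat A '' Y) := by
    refine (root_spec hn).2 A ?_
    rintro _ ⟨y, -, rfl⟩
    exact isPrefixOf_cat A y
  have h1 : t <+: root Y := by
    refine (root_spec hY).2 t fun y hy => ?_
    have := (root_spec hn).1 _ (Set.mem_image_of_mem _ hy)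
    rwa [← ht, isPrefixOf_append_cat] at this
  have h2 : A ++ root Y <+: A ++ t := by
    rw [ht]
    refine (root_spec hn).2 _ ?_
    rintro _ ⟨y, hy, rfl⟩
    exact isPrefixOf_append_cat.2 ((root_spec hY).1 y hy)
  rw [← ht, h1.eq_of_length_le ((List.prefix_append_right_inj A).1 h2).length_le]

theorem nontrivial_range {X β : Type} [Nontrivial X] {F : X → β} (hF : Function.Injective F) :
    (Set.range F).Nontrivial := by
  obtain ⟨x, y, hxy⟩ := exists_pair_ne X
  exact ⟨_, ⟨x, rfl⟩, _, ⟨y, rfl⟩, hF.ne hxy⟩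

/-- A sequence-valued map with the longest common prefix of its values removed. The local action
of `h` at `ν` is the reduction of `x ↦ h (ν ⌢ x)`. -/
noncomputable def reduce {X : Type} (F : X → ℕ → α) : X → ℕ → α :=
  fun z => dropSeq (root (Set.range F)).length (F z)

variable {X : Type} [Nontrivial X] {F : X → ℕ → α}

theorem cat_root_reduce (hF : Function.Injective F) (z : X) :
    cat (root (Set.range F)) (reduce F z) = F z :=
  ((root_spec (nontrivial_range hF)).1 _ ⟨z, rfl⟩).cat_dropSeq

theorem reduce_injective (hF : Function.Injective F) : Function.Injective (reduce F) := by
  intro x y h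
  apply hF
  rw [← cat_root_reduce hF x, ← cat_root_reduce hF y, h]

theorem root_range_cat (A : List α) (hF : Function.Injective F) :
    root (Set.range fun z => cat A (F z)) = A ++ root (Set.range F) := by
  rw [← root_image_cat A (nontrivial_range hF), ← Set.range_comp]
  rfl

theorem reduce_cat (A : List α) (hF : Function.Injective F) :
    reduce (fun z => cat A (F z)) = reduce F := by
  funext z
  rw [reduce, root_range_cat A hF, List.length_append, ← dropSeq_dropSeq, dropSeq_length_cat]
  rfl

end Sequences

/-! ### Cones and compactness of the Cantor space -/

section Topology

theorem isOpen_setOf_isPrefixOf {α : Type} [TopologicalSpace α] [DiscreteTopology α] (w : List α) :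
    IsOpen {y : ℕ → α | IsPrefixOf w y} := by
  simp only [isPrefixOf_iff_forall, Set.ofPred_forall]
  refine isOpen_iInter_of_finite fun i => ?_
  have hc : Continuous fun y : ℕ → α => y i := continuous_apply (i : ℕ)
  exact (isOpen_discrete ({w[i]} : Set α)).preimage hc

theorem exists_cat_takeSeq_mem {n : ℕ} {U : Set (Cantor n)} (hU : IsOpen U) {x : Cantor n}
    (hx : x ∈ U) : ∃ k, ∀ z, cat (takeSeq k x) z ∈ U := by
  obtain ⟨I, u, hu, hsub⟩ := isOpen_pi_iff.1 hU x hx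
  refine ⟨I.sup id + 1, fun z => hsub fun i hi => ?_⟩
  have hi' : i < I.sup id + 1 := Nat.lt_succ_of_le (Finset.le_sup (f := id) hi)
  rw [cat_takeSeq_apply hi']
  exact (hu i hi).2

/-- A property of words that passes to extensions and holds for some prefix of every infinite
sequence holds for all sufficiently long words, by compactness. -/
theorem exists_forall_length_le {n : ℕ} [Nonempty (Fin n)] {P : List (Fin n) → Prop}
    (hmono : ∀ u v, u <+: v → P u → P v) (hP : ∀ x : Cantor n, ∃ k, P (takeSeq k x)) :
    ∃ N, ∀ w, N ≤ w.length → P w := by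
  choose k hk using hP
  obtain ⟨t, ht⟩ := (isCompact_univ (X := Cantor n)).elim_finite_subcover
    (fun x => {y : Cantor n | IsPrefixOf (takeSeq (k x) x) y})
    (fun x => isOpen_setOf_isPrefixOf _)
    (fun x _ => Set.mem_iUnion.2 ⟨x, isPrefixOf_takeSeq _ _⟩)
  refine ⟨t.sup k, fun w hw => ?_⟩
  let z : Cantor n := fun _ => Classical.arbitrary _
  obtain ⟨x, hxt, hx⟩ := Set.mem_iUnion₂.1 (ht (Set.mem_univ (cat w z)))
  refine hmono _ _ (IsPrefixOf.prefix hx (isPrefixOf_cat w z) ?_) (hk x)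
  rw [length_takeSeq]
  exact (Finset.le_sup hxt).trans hw

theorem continuous_cat {α : Type} [TopologicalSpace α] (w : List α) :
    Continuous (cat w : (ℕ → α) → ℕ → α) := by
  refine continuous_pi fun i => ?_
  by_cases h : i < w.length
  · simpa [cat, h] using continuous_const
  · simpa [cat, h] using continuous_apply _

variable {n r : ℕ}

theorem Word.continuous_cat (ν : Word n r) : Continuous ν.cat :=
  continuous_const.prodMk (HigmanThompson.continuous_cat ν.2)

theorem continuous_toSeq : Continuous (CantorR.toSeq : CantorR n r → ℕ → Letter n r) := by
  refine continuous_pi fun i => ?_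
  cases i with
  | zero => exact continuous_inl.comp continuous_fst
  | succ i =>
    have : (fun p : CantorR n r => p.toSeq (i + 1)) = fun p => Sum.inr (p.2 i) := by
      funext p
      simp [CantorR.toSeq, cat, Cantor.toSeq]
    rw [this]
    exact continuous_inr.comp ((continuous_apply i).comp continuous_snd)

end Topology

/-! ### Words over the joint alphabet -/

section Letters

variable {n r : ℕ}

/-- A word of `W_{n,r,ε}`, spelled over the joint alphabet. -/
def Word.toList (ν : Word n r) : List (Letter n r) := Sum.inl ν.1 :: ν.2.map Sum.inr

theorem cantorToSeq_injective : Function.Injective (Cantor.toSeq (n := n) r) := by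
  intro x y h
  funext i
  exact Sum.inr_injective (congrFun h i)

theorem toSeq_injective : Function.Injective (CantorR.toSeq (n := n) (r := r)) := by
  intro p q h
  refine Prod.ext ?_ ?_
  · simpa [CantorR.toSeq, cat] using congrFun h 0
  · funext i
    simpa [CantorR.toSeq, cat, Cantor.toSeq] using congrFun h (i + 1)

theorem cat_map_inr (w : List (Fin n)) (x : Cantor n) :
    cat (w.map Sum.inr) (Cantor.toSeq r x) = Cantor.toSeq r (cat w x) := by
  funext i
  by_cases h : i < w.length <;> simp [cat, Cantor.toSeq, h]

theorem toSeq_cat (ν : Word n r) (x : Cantor n) :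
    (ν.cat x).toSeq = cat ν.toList (Cantor.toSeq r x) := by
  rw [CantorR.toSeq, Word.cat, ← cat_map_inr, ← cat_append]
  rfl

theorem cat_fst_nil_snd (p : CantorR n r) : Word.cat (p.1, []) p.2 = p := by
  simp only [Word.cat, cat_nil]

theorem exists_cat_of_isPrefixOf {ν : Word n r} {p : CantorR n r}
    (h : IsPrefixOf ν.toList p.toSeq) : ∃ x, p = ν.cat x := by
  have h1 := isPrefixOf_iff_forall.1 h
  have h0 := h1 ⟨0, by simp [Word.toList]⟩
  refine ⟨dropSeq ν.2.length p.2, Prod.ext ?_ ?_⟩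
  · simpa [CantorR.toSeq, cat, Word.toList, Word.cat] using h0
  · refine (IsPrefixOf.cat_dropSeq (isPrefixOf_iff_forall.2 fun i => ?_)).symm
    simpa [CantorR.toSeq, cat, Word.toList, Cantor.toSeq] using
      h1 ⟨i + 1, by simp [Word.toList]⟩

theorem isPlainWord_of_isPrefixOf {w : List (Letter n r)} {x : Cantor n}
    (h : IsPrefixOf w (Cantor.toSeq r x)) : IsPlainWord w := by
  refine ⟨takeSeq w.length x, ?_⟩
  refine (h.prefix (v := (takeSeq w.length x).map Sum.inr) ?_ (by simp)).eq_of_length (by simp)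
  refine ⟨Cantor.toSeq r (dropSeq w.length x), ?_⟩
  rw [cat_map_inr, cat_takeSeq_dropSeq]

theorem isDottedWord_of_isPrefixOf {w : List (Letter n r)} {p : CantorR n r} (hw : w ≠ [])
    (h : IsPrefixOf w p.toSeq) : IsDottedWord w := by
  cases w with
  | nil => exact absurd rfl hw
  | cons c w =>
    have hc : c = Sum.inl p.1 := by
      have := isPrefixOf_iff_forall.1 h ⟨0, by simp⟩
      simpa [CantorR.toSeq, cat] using this.symm
    subst hc
    obtain ⟨u, rfl⟩ := isPlainWord_of_isPrefixOf
      (isPrefixOf_append_cat (u := [Sum.inl p.1]) (v := w).1 h)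
    exact ⟨_, u, rfl⟩

theorem isPlainWord_of_append {u v : List (Letter n r)} {p : CantorR n r} (hu : u ≠ [])
    (h : IsPrefixOf (u ++ v) p.toSeq) : IsPlainWord v := by
  obtain ⟨c, u, rfl⟩ := List.exists_cons_of_ne_nil hu
  have hc : c = Sum.inl p.1 := by
    have := isPrefixOf_iff_forall.1 h ⟨0, by simp⟩
    simpa [CantorR.toSeq, cat] using this.symm
  subst hc
  obtain ⟨t, ht⟩ := isPlainWord_of_isPrefixOf
    (isPrefixOf_append_cat (u := [Sum.inl p.1]) (v := u ++ v).1 h)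
  refine ⟨t.drop u.length, ?_⟩
  rw [List.map_drop, ← ht, List.drop_left]

/-- The word `ν ⌢ w`. -/
def Word.append (ν : Word n r) (w : List (Fin n)) : Word n r := (ν.1, ν.2 ++ w)

theorem Word.append_cat (ν : Word n r) (w : List (Fin n)) (x : Cantor n) :
    (ν.append w).cat x = ν.cat (HigmanThompson.cat w x) := by
  simp only [Word.append, Word.cat, HigmanThompson.cat_append]

theorem Word.append_nil (ν : Word n r) : ν.append [] = ν := by
  simp [Word.append]

theorem Word.append_append (ν : Word n r) (u v : List (Fin n)) :
    (ν.append u).append v = ν.append (u ++ v) := by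
  simp [Word.append]

theorem produces_unique {Q α : Type} {π : Fin n → Q → Q} {out : Fin n → Q → List α} {q : Q}
    {x : Cantor n} {y z : ℕ → α} (hy : Produces π out q x y) (hz : Produces π out q x z) :
    y = z := by
  funext i
  obtain ⟨k, hk⟩ := hy.2 (i + 1)
  have h1 := isPrefixOf_iff_forall.1 (hy.1 k) ⟨i, hk⟩
  have h2 := isPrefixOf_iff_forall.1 (hz.1 k) ⟨i, hk⟩
  exact h1.trans h2.symm

end Letters

/-! ### Elements of `G_{n,r}` from partitions into cones -/

section HigmanGroup

variable {n r : ℕ}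

/-- Two finite families of words whose cones partition `𝔠_{n,r}` define an element of `G_{n,r}`
that replaces the one family of prefixes by the other. -/
theorem exists_mem_higmanGroup_of_partition {ι : Type} [Fintype ι] (hn : 0 < n) {η ζ : ι → Word n r}
    (hη : ∀ p, ∃! i, ∃ x, p = (η i).cat x) (hζ : ∀ p, ∃! i, ∃ x, p = (ζ i).cat x) :
    ∃ g ∈ higmanGroup n r, ∀ i x, g ((η i).cat x) = (ζ i).cat x := by
  let _ : TopologicalSpace ι := ⊥
  have key : ∀ w : ι → Word n r, (∀ p, ∃! i, ∃ x, p = (w i).cat x) →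
      ∃ e : (Σ _ : ι, Cantor n) ≃ₜ CantorR n r, ∀ i x, e ⟨i, x⟩ = (w i).cat x := fun w hw => by
    let f : (Σ _ : ι, Cantor n) → CantorR n r := fun s => (w s.1).cat s.2
    have hf : Function.Bijective f := by
      refine ⟨?_, fun p => ?_⟩
      · rintro ⟨i, x⟩ ⟨j, y⟩ hxy
        obtain rfl : i = j := (hw (f ⟨i, x⟩)).unique ⟨x, rfl⟩ ⟨y, hxy⟩
        exact congrArg _ ((w i).cat_injective hxy)
      · obtain ⟨i, ⟨x, hx⟩, -⟩ := hw p
        exact ⟨⟨i, x⟩, hx.symm⟩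
    have hcont : Continuous f := continuous_sigma fun i => (w i).continuous_cat
    exact ⟨Continuous.homeoOfEquivCompactToT2 (f := Equiv.ofBijective f hf) hcont,
      fun i x => rfl⟩
  obtain ⟨e, he⟩ := key η hη
  obtain ⟨e', he'⟩ := key ζ hζ
  have hg : ∀ i x, (e.symm.trans e') ((η i).cat x) = (ζ i).cat x := fun i x => by
    rw [← he, ← he', Homeomorph.trans_apply, e.symm_apply_apply]
  have hmax : ∀ w : ι → Word n r, (∀ p, ∃! i, ∃ x, p = (w i).cat x) →
      IsMaximalAntichain fun i => w ((Fintype.equivFin ι).symm i) := fun w hw =>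
    isMaximalAntichain_of_existsUnique hn fun p =>
      ((Fintype.equivFin ι).symm.bijective.existsUnique_iff).1 (hw p)
  exact ⟨e.symm.trans e', ⟨_, _, _, hmax η hη, hmax ζ hζ, fun i x => hg _ x⟩, hg⟩

/-- The group `G_{n,r}` contains an element replacing the prefix `a b c` by `a d`, if `d ≠ b`: it
interchanges these two members of the antichain of all words with one undotted letter in which
`a b` has been split into its children. -/
theorem exists_mem_higmanGroup_cat_eq (hn : 0 < n) (a : Fin r) {b d : Fin n} (c : Fin n)
    (hbd : d ≠ b) :
    ∃ g ∈ higmanGroup n r, ∀ x, g (Word.cat (a, [b, c]) x) = Word.cat (a, [d]) x := by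
  classical
  let ι := {p : Fin r × Fin n // p ≠ (a, b)} ⊕ Fin n
  let η : ι → Word n r := Sum.elim (fun p => (p.1.1, [p.1.2])) (fun e => (a, [b, e]))
  have hl : ∀ (p : CantorR n r) q, (∃ x, p = (η (Sum.inl q)).cat x) ↔ q.1 = (p.1, p.2 0) := by
    rintro p ⟨⟨s, t⟩, hq⟩
    constructor
    · rintro ⟨x, rfl⟩
      simp [η, Word.cat, cat]
    · rintro hp
      obtain ⟨rfl, rfl⟩ := Prod.ext_iff.1 hp
      exact ⟨dropSeq 1 p.2, Prod.ext rfl (cat_takeSeq_dropSeq 1 p.2).symm⟩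
  have hr : ∀ (p : CantorR n r) e, (∃ x, p = (η (Sum.inr e)).cat x) ↔
      (a, b) = (p.1, p.2 0) ∧ e = p.2 1 := by
    intro p e
    constructor
    · rintro ⟨x, rfl⟩
      simp [η, Word.cat, cat]
    · rintro ⟨hp, rfl⟩
      obtain ⟨rfl, rfl⟩ := Prod.ext_iff.1 hp
      exact ⟨dropSeq 2 p.2, Prod.ext rfl (cat_takeSeq_dropSeq 2 p.2).symm⟩
  have hη : ∀ p, ∃! i, ∃ x, p = (η i).cat x := fun p => by
    by_cases hp : (p.1, p.2 0) = (a, b)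
    · refine ⟨Sum.inr (p.2 1), (hr _ _).2 ⟨hp.symm, rfl⟩, ?_⟩
      rintro (q | e) hi
      · exact absurd (((hl _ _).1 hi).trans hp) q.2
      · rw [((hr _ _).1 hi).2]
    · refine ⟨Sum.inl ⟨_, hp⟩, (hl _ _).2 rfl, ?_⟩
      rintro (q | e) hi
      · rw [Sum.inl.injEq]
        exact Subtype.ext ((hl _ _).1 hi)
      · exact absurd ((hr _ _).1 hi).1.symm hp
  let d' : ι := Sum.inl ⟨(a, d), fun hd => hbd (Prod.ext_iff.1 hd).2⟩
  let σ : Equiv.Perm ι := Equiv.swap (Sum.inr c) d'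
  obtain ⟨g, hg, hgη⟩ := exists_mem_higmanGroup_of_partition (ζ := fun i => η (σ i)) hn hη
    fun p => (σ.bijective.existsUnique_iff).1 (hη p)
  refine ⟨g, hg, fun x => ?_⟩
  have := hgη (Sum.inr c) x
  simp only [σ, Equiv.swap_apply_left] at this
  exact this

end HigmanGroup

/-! ### Local actions along words -/

section LocalAction

variable {n r : ℕ} (h : CantorR n r ≃ₜ CantorR n r)

/-- The map `x ↦ h (ν ⌢ x)`, with values viewed as sequences over the joint alphabet. -/
def coneMap (ν : Word n r) : Cantor n → ℕ → Letter n r := fun x => (h (ν.cat x)).toSeq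

theorem coneMap_injective (ν : Word n r) : Function.Injective (coneMap h ν) :=
  toSeq_injective.comp (h.injective.comp ν.cat_injective)

theorem continuous_coneMap (ν : Word n r) : Continuous (coneMap h ν) :=
  continuous_toSeq.comp (h.continuous.comp ν.continuous_cat)

theorem coneMap_append (ν : Word n r) (w : List (Fin n)) :
    coneMap h (ν.append w) = fun z => coneMap h ν (cat w z) := by
  funext z
  simp only [coneMap, Word.append_cat]

/-- Away from `R` the local action takes values in `𝔠_n`. -/
theorem exists_localAction_eq_toSeq {ν : Word n r} (hν : rootFun h ν ≠ []) (x : Cantor n) :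
    ∃ y, localAction h ν x = Cantor.toSeq r y := by
  obtain ⟨m, hm⟩ := Nat.exists_eq_succ_of_ne_zero (List.length_pos_iff.2 hν).ne'
  refine ⟨dropSeq m (h (ν.cat x)).2, ?_⟩
  funext i
  change (h (ν.cat x)).toSeq ((rootFun h ν).length + i) = _
  rw [hm, show m.succ + i = m + i + 1 by omega]
  simp [CantorR.toSeq, cat, Cantor.toSeq, dropSeq]

/-- The local action at `ν`, as a state. -/
noncomputable def actionState (ν : Word n r) : Set.range (localAction h) :=
  ⟨localAction h ν, ν, rfl⟩

theorem exists_actionState_eq (q : Set.range (localAction h)) : ∃ ν, actionState h ν = q := by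
  obtain ⟨_, ν, rfl⟩ := q
  exact ⟨ν, rfl⟩

variable [Nontrivial (Fin n)]

theorem cat_rootFun_localAction (ν : Word n r) (x : Cantor n) :
    cat (rootFun h ν) (localAction h ν x) = coneMap h ν x :=
  cat_root_reduce (coneMap_injective h ν) x

theorem localAction_injective (ν : Word n r) : Function.Injective (localAction h ν) :=
  reduce_injective (coneMap_injective h ν)

theorem localAction_cat_injective (ν : Word n r) (w : List (Fin n)) :
    Function.Injective fun z => localAction h ν (cat w z) :=
  (localAction_injective h ν).comp (cat_injective w)

theorem coneMap_append_eq_cat (ν : Word n r) (w : List (Fin n)) :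
    coneMap h (ν.append w) = fun z => cat (rootFun h ν) (localAction h ν (cat w z)) := by
  simp only [coneMap_append, cat_rootFun_localAction]

/-- The root at `ν ⌢ w` is determined by the root and the local action at `ν`. -/
theorem rootFun_append (ν : Word n r) (w : List (Fin n)) :
    rootFun h (ν.append w) =
      rootFun h ν ++ root (Set.range fun z => localAction h ν (cat w z)) := by
  rw [← root_range_cat _ (localAction_cat_injective h ν w), ← coneMap_append_eq_cat]
  rfl

/-- The local action at `ν ⌢ w` is determined by the local action at `ν`. -/
theorem localAction_append (ν : Word n r) (w : List (Fin n)) :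
    localAction h (ν.append w) = reduce fun z => localAction h ν (cat w z) := by
  rw [← reduce_cat (rootFun h ν) (localAction_cat_injective h ν w), ← coneMap_append_eq_cat]
  rfl

theorem isPrefixOf_rootFun (ν : Word n r) (x : Cantor n) :
    IsPrefixOf (rootFun h ν) (coneMap h ν x) :=
  ⟨_, (cat_rootFun_localAction h ν x).symm⟩

/-- By continuity of `h`, the roots along the prefixes of an infinite sequence grow without
bound. -/
theorem exists_le_length_rootFun (ν : Word n r) (x : Cantor n) (N : ℕ) :
    ∃ k, N ≤ (rootFun h (ν.append (takeSeq k x))).length := by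
  obtain ⟨k, hk⟩ := exists_cat_takeSeq_mem
    ((isOpen_setOf_isPrefixOf (takeSeq N (coneMap h ν x))).preimage (continuous_coneMap h ν))
    (x := x) (isPrefixOf_takeSeq _ _)
  refine ⟨k, ?_⟩
  have hroot := root_spec (nontrivial_range (coneMap_injective h (ν.append (takeSeq k x))))
  have hpre : takeSeq N (coneMap h ν x) <+: rootFun h (ν.append (takeSeq k x)) := by
    refine hroot.2 _ ?_
    rintro _ ⟨z, rfl⟩
    rw [coneMap_append]
    exact hk z
  simpa only [length_takeSeq] using hpre.length_le

/-- A state is in the part `R` exactly when nothing has been written yet. -/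
theorem rootFun_eq_nil_iff (ν : Word n r) (x : Cantor n) :
    rootFun h ν = [] ↔ ∃ a, localAction h ν x 0 = Sum.inl a := by
  have hx := cat_rootFun_localAction h ν x
  constructor
  · intro h0
    rw [h0, cat_nil] at hx
    exact ⟨(h (ν.cat x)).1, by rw [hx]; simp [coneMap, CantorR.toSeq, cat]⟩
  · rintro ⟨a, ha⟩
    by_contra hne
    have hpos : 0 < (rootFun h ν).length := List.length_pos_iff.2 hne
    have h1 := congrFun hx ((rootFun h ν).length + 0)
    obtain ⟨m, hm⟩ := Nat.exists_eq_succ_of_ne_zero hpos.ne'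
    have h2 : cat (rootFun h ν) (localAction h ν x) ((rootFun h ν).length + 0) = Sum.inl a := by
      simpa [cat] using ha
    rw [h2, hm] at h1
    simp [coneMap, CantorR.toSeq, cat, Cantor.toSeq] at h1

/-! ### Finiteness of the set of local actions -/

/-- If `g` replaces the prefix `ν` by `η` and the conjugate of `g` by `h` is a prefix code map, then
the local actions of `h` at `ν ⌢ w` and `η ⌢ w` agree for all long `w`: the conjugate carries
`h (ν ⌢ w ⌢ x)` to `h (η ⌢ w ⌢ x)`, and on the image of a small cone it only changes a prefix. -/
theorem exists_forall_localAction_append_eq {h g : CantorR n r ≃ₜ CantorR n r}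
    (hc : conjugate h g ∈ higmanGroup n r) {ν η : Word n r} (hg : ∀ x, g (ν.cat x) = η.cat x) :
    ∃ N, ∀ w : List (Fin n), N ≤ w.length →
      localAction h (ν.append w) = localAction h (η.append w) := by
  obtain ⟨k, α, β, hα, -, hf⟩ := hc
  have hbar : ∃ N, ∀ w : List (Fin n), N ≤ w.length →
      ∃ i, ∀ z, ∃ y, h (ν.cat (cat w z)) = (α i).cat y := by
    refine exists_forall_length_le ?_ fun x => ?_
    · rintro u _ ⟨t, rfl⟩ ⟨i, hi⟩
      exact ⟨i, fun z => by rw [cat_append]; exact hi _⟩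
    · obtain ⟨i, ⟨y, hy⟩, -⟩ := hα.existsUnique (h (ν.cat x))
      obtain ⟨m, hm⟩ := exists_cat_takeSeq_mem
        ((isOpen_setOf_isPrefixOf (α i).toList).preimage (continuous_coneMap h ν)) (x := x)
        ⟨_, by rw [coneMap, hy, toSeq_cat]⟩
      exact ⟨m, i, fun z => exists_cat_of_isPrefixOf (hm z)⟩
  obtain ⟨N, hN⟩ := hbar
  refine ⟨N, fun w hw => ?_⟩
  obtain ⟨i, hi⟩ := hN w hw
  choose y hy using hi
  have hy' : ∀ z, h (η.cat (cat w z)) = (β i).cat (y z) := fun z => by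
    rw [← hf, ← hy, ← hg]
    simp [conjugate]
  have hinj : Function.Injective fun z => Cantor.toSeq r (y z) := by
    refine cantorToSeq_injective.comp fun a b hab => ?_
    have : h (ν.cat (cat w a)) = h (ν.cat (cat w b)) := by rw [hy, hy, hab]
    exact cat_injective w (ν.cat_injective (h.injective this))
  have h1 : coneMap h (ν.append w) = fun z => cat (α i).toList (Cantor.toSeq r (y z)) := by
    funext z
    rw [coneMap, Word.append_cat, hy, toSeq_cat]
  have h2 : coneMap h (η.append w) = fun z => cat (β i).toList (Cantor.toSeq r (y z)) := by
    funext z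
    rw [coneMap, Word.append_cat, hy', toSeq_cat]
  change reduce (coneMap h (ν.append w)) = reduce (coneMap h (η.append w))
  rw [h1, h2, reduce_cat _ hinj, reduce_cat _ hinj]

/-- Every sufficiently long word has the local action of a word that is shorter by one letter, so
the local actions at the words of bounded length are all of them. -/
theorem finite_range_localAction {h : CantorR n r ≃ₜ CantorR n r}
    (hG : ∀ g ∈ higmanGroup n r, conjugate h g ∈ higmanGroup n r) :
    (Set.range (localAction h)).Finite := by
  have hn : 0 < n := Fin.pos_iff_nonempty.2 inferInstance
  have hex : ∀ t : Fin r × Fin n × Fin n, ∃ (d : Fin n) (N : ℕ), ∀ w : List (Fin n),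
      N ≤ w.length → localAction h (t.1, t.2.1 :: t.2.2 :: w) = localAction h (t.1, d :: w) := by
    rintro ⟨a, b, c⟩
    obtain ⟨d, hd⟩ := exists_ne b
    obtain ⟨g, hg, hgx⟩ := exists_mem_higmanGroup_cat_eq hn a c hd
    obtain ⟨N, hN⟩ := exists_forall_localAction_append_eq (hG g hg) hgx
    exact ⟨d, N, hN⟩
  choose d N hN using hex
  set M := Finset.univ.sup N with hM
  have hbound : ∀ (m : ℕ) (a : Fin r) (u : List (Fin n)), u.length = m →
      localAction h (a, u) ∈
        localAction h '' (Set.univ ×ˢ {u : List (Fin n) | u.length ≤ M + 1}) := by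
    intro m
    induction m with
    | zero => exact fun a u hu => ⟨(a, u), ⟨trivial, by simp [hu]⟩, rfl⟩
    | succ m ih =>
      intro a u hu
      by_cases hle : u.length ≤ M + 1
      · exact ⟨(a, u), ⟨trivial, hle⟩, rfl⟩
      · obtain _ | ⟨b, _ | ⟨c, w⟩⟩ := u
        · simp at hle
        · simp at hle
        · simp only [List.length_cons] at hle hu
          have hw : N (a, b, c) ≤ w.length :=
            (Finset.le_sup (Finset.mem_univ _)).trans (by omega : M ≤ w.length)
          rw [hN (a, b, c) w hw]
          exact ih a _ (by simpa using hu)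
  refine ((Set.finite_univ.prod (List.finite_length_le (Fin n) (M + 1))).image
    (localAction h)).subset ?_
  rintro _ ⟨⟨a, u⟩, rfl⟩
  exact hbound _ a u rfl

/-! ### The transducer of local actions -/

/-- The output on the word `w` in the state `q`, when states are local actions. -/
noncomputable def actionOut (w : List (Fin n)) (q : Cantor n → ℕ → Letter n r) :
    List (Letter n r) :=
  root (Set.range fun z => q (cat w z))

/-- The transition along a letter, when the states are the local actions of `h`. -/
noncomputable def actionStep (x : Fin n) (q : Set.range (localAction h)) :
    Set.range (localAction h) :=
  ⟨reduce fun z => q.1 (cat [x] z), by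
    obtain ⟨_, ν, rfl⟩ := q
    exact ⟨ν.append [x], localAction_append h ν [x]⟩⟩

theorem actionStep_actionState (x : Fin n) (ν : Word n r) :
    actionStep h x (actionState h ν) = actionState h (ν.append [x]) :=
  Subtype.ext (localAction_append h ν [x]).symm

theorem runState_actionState (w : List (Fin n)) (ν : Word n r) :
    runState (actionStep h) w (actionState h ν) = actionState h (ν.append w) := by
  induction w generalizing ν with
  | nil => rw [Word.append_nil]; rfl
  | cons x w ih => rw [runState, actionStep_actionState, ih, Word.append_append]; rfl

theorem rootFun_append_eq_runOut (w : List (Fin n)) (ν : Word n r) :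
    rootFun h (ν.append w) = rootFun h ν ++
      runOut (actionStep h) (fun x q => actionOut [x] q.1) w (actionState h ν) := by
  induction w generalizing ν with
  | nil => simp [Word.append_nil, runOut]
  | cons x w ih =>
    rw [runOut, actionStep_actionState, ← List.append_assoc]
    have : ν.append (x :: w) = (ν.append [x]).append w := by simp [Word.append_append]
    rw [this, ih, rootFun_append h ν [x]]
    rfl

theorem produces_localAction (ν : Word n r) (x : Cantor n) :
    Produces (actionStep h) (fun x q => actionOut [x] q.1) (actionState h ν) x
      (localAction h ν x) := by
  refine ⟨fun k => ?_, fun N => ?_⟩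
  · have h1 := isPrefixOf_rootFun h (ν.append (takeSeq k x)) (dropSeq k x)
    rw [coneMap_append_eq_cat, rootFun_append_eq_runOut] at h1
    simp only [cat_takeSeq_dropSeq] at h1
    exact isPrefixOf_append_cat.1 h1
  · obtain ⟨k, hk⟩ := exists_le_length_rootFun h ν x ((rootFun h ν).length + N)
    rw [rootFun_append_eq_runOut, List.length_append] at hk
    exact ⟨k, Nat.le_of_add_le_add_left hk⟩

theorem produces_iff (q : Set.range (localAction h)) (x : Cantor n) (y : ℕ → Letter n r) :
    Produces (actionStep h) (fun x q => actionOut [x] q.1) q x y ↔ y = q.1 x := by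
  obtain ⟨_, ν, rfl⟩ := q
  constructor
  · exact fun hy => produces_unique hy (produces_localAction h ν x)
  · rintro rfl
    exact produces_localAction h ν x

/-- The part `R` of the state set: the local actions with values in `𝔠_{n,r}`. -/
def actionR : Set (Set.range (localAction h)) := {q | ∀ x, ∃ a, q.1 x 0 = Sum.inl a}

theorem actionState_mem_actionR {ν : Word n r} :
    actionState h ν ∈ actionR h ↔ rootFun h ν = [] :=
  ⟨fun hν => (rootFun_eq_nil_iff h ν (Classical.arbitrary _)).2 (hν _),
    fun hν x => (rootFun_eq_nil_iff h ν x).1 hν⟩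

/-- The transducer whose states are the local actions of `h`, for `h` with finitely many of them. -/
noncomputable def actionTransducer (hfin : (Set.range (localAction h)).Finite) :
    Transducer n r where
  Q := Set.range (localAction h)
  R := actionR h
  π₀ a := actionState h (a, [])
  out₀ a := rootFun h (a, [])
  π := actionStep h
  out x q := actionOut [x] q.1
  finite_R := have := hfin.to_subtype; Set.toFinite _
  countable_Q := have := hfin.to_subtype; Finite.to_countable
  init_to_R a ha := (actionState_mem_actionR h).1 ha
  to_R x q hq := by
    obtain ⟨ν, rfl⟩ := exists_actionState_eq h q
    rw [actionStep_actionState, actionState_mem_actionR, rootFun_append,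
      List.append_eq_nil_iff] at hq
    exact ⟨(actionState_mem_actionR h).2 hq.1, hq.2⟩
  init_to_S a ha := isDottedWord_of_isPrefixOf (fun h0 => ha ((actionState_mem_actionR h).2 h0))
    (isPrefixOf_rootFun h _ (Classical.arbitrary _))
  R_to_S x q hq hx := by
    obtain ⟨ν, rfl⟩ := exists_actionState_eq h q
    rw [actionStep_actionState] at hx
    have h0 : rootFun h (ν.append [x]) = actionOut [x] (actionState h ν).1 := by
      rw [rootFun_append, (actionState_mem_actionR h).1 hq]
      rfl
    rw [← h0]
    exact isDottedWord_of_isPrefixOf (fun h0 => hx ((actionState_mem_actionR h).2 h0))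
      (isPrefixOf_rootFun h _ (Classical.arbitrary _))
  S_to_S x q hq := by
    obtain ⟨ν, rfl⟩ := exists_actionState_eq h q
    rw [actionState_mem_actionR] at hq
    have h0 := isPrefixOf_rootFun h (ν.append [x]) (Classical.arbitrary _)
    rw [rootFun_append] at h0
    refine ⟨isPlainWord_of_append hq h0, ?_⟩
    rw [actionStep_actionState, actionState_mem_actionR, rootFun_append]
    simp [hq]
  cycle q w hw hq hout := by
    obtain ⟨ν, rfl⟩ := exists_actionState_eq h q
    rw [runState_actionState] at hq
    have hq' : localAction h (ν.append w) = localAction h ν := congrArg Subtype.val hq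
    have hroot := rootFun_append_eq_runOut h w ν
    rw [hout, List.append_nil] at hroot
    obtain ⟨b, w, rfl⟩ := List.exists_cons_of_ne_nil hw
    obtain ⟨c, hc⟩ := exists_ne b
    -- A loop with empty output would give `ν ⌢ w ⌢ x` and `ν ⌢ x` the same image for every `x`.
    have h1 := cat_rootFun_localAction h (ν.append (b :: w)) (fun _ => c)
    rw [hroot, hq', cat_rootFun_localAction, coneMap_append] at h1
    have h2 := congrFun (coneMap_injective h ν h1) 0
    exact hc (by simpa [cat] using h2)
  infinite_output q hq x := by
    obtain ⟨ν, rfl⟩ := exists_actionState_eq h q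
    rw [actionState_mem_actionR] at hq
    obtain ⟨y, hy⟩ := exists_localAction_eq_toSeq h hq x
    exact ⟨y, hy ▸ produces_localAction h ν x⟩

theorem actionTransducer_writes_iff (hfin : (Set.range (localAction h)).Finite)
    (p : CantorR n r) (y : ℕ → Letter n r) :
    (actionTransducer h hfin).Writes p y ↔ y = (h p).toSeq := by
  have hp : cat (rootFun h (p.1, [])) (localAction h (p.1, []) p.2) = (h p).toSeq := by
    rw [cat_rootFun_localAction, coneMap, cat_fst_nil_snd]
  constructor
  · rintro ⟨z, hz, rfl⟩
    rw [← hp, (produces_iff h _ _ _).1 hz]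
    rfl
  · rintro rfl
    exact ⟨_, produces_localAction h _ _, hp.symm⟩

theorem actionTransducer_stateAt (hfin : (Set.range (localAction h)).Finite)
    (ν : Word n r) :
    (actionTransducer h hfin).stateAt ν = actionState h ν :=
  runState_actionState h ν.2 (ν.1, [])

theorem actionTransducer_outAt (hfin : (Set.range (localAction h)).Finite)
    (ν : Word n r) :
    (actionTransducer h hfin).outAt ν = rootFun h ν :=
  (rootFun_append_eq_runOut h ν.2 (ν.1, [])).symm

theorem actionTransducer_isMinimal (hfin : (Set.range (localAction h)).Finite) :
    (actionTransducer h hfin).IsMinimal := by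
  refine ⟨fun q => ?_, ?_, fun q₁ q₂ hq => ?_⟩
  · obtain ⟨ν, rfl⟩ := exists_actionState_eq h q
    exact ⟨ν, actionTransducer_stateAt h hfin ν⟩
  · rintro q ⟨ν, -, -, hne⟩
    apply hne
    rw [actionTransducer_outAt]
    simp only [actionTransducer_writes_iff]
    refine congrArg root (Set.ext fun y => ?_)
    exact exists_congr fun x => eq_comm
  · refine Subtype.ext (funext fun x => ?_)
    exact (produces_iff h q₂ x _).1 ((hq x _).1 ((produces_iff h q₁ x _).2 rfl))

/-- A homeomorphism with finitely many local actions is represented by the transducer of its local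
actions. -/
theorem mem_rationalGroup (hfin : (Set.range (localAction h)).Finite) :
    h ∈ rationalGroup n r :=
  ⟨actionTransducer h hfin, hfin.to_subtype, actionTransducer_isMinimal h hfin,
    fun p => (actionTransducer_writes_iff h hfin p _).2 rfl⟩

end LocalAction

end HigmanThompson

theorem theorem6p1 (n r : ℕ) (hr : 1 ≤ r) (hrn : r < n) :
    (∀ h : HigmanThompson.CantorR n r ≃ₜ HigmanThompson.CantorR n r,
      (∀ g ∈ HigmanThompson.higmanGroup n r,
        HigmanThompson.conjugate h g ∈ HigmanThompson.higmanGroup n r) →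
      (Set.range (HigmanThompson.localAction h)).Finite ∧
        h ∈ HigmanThompson.rationalGroup n r) ∧
    (∀ (φ : MulAut (HigmanThompson.higmanGroup n r))
      (h : HigmanThompson.CantorR n r ≃ₜ HigmanThompson.CantorR n r),
      HigmanThompson.IsRubinConjugator φ h →
      (Set.range (HigmanThompson.localAction h)).Finite ∧
        h ∈ HigmanThompson.rationalGroup n r) := by
  have : Nontrivial (Fin n) := Fin.nontrivial_iff_two_le.2 (by omega)
  have main : ∀ h : HigmanThompson.CantorR n r ≃ₜ HigmanThompson.CantorR n r,
      (∀ g ∈ HigmanThompson.higmanGroup n r,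
        HigmanThompson.conjugate h g ∈ HigmanThompson.higmanGroup n r) →
      (Set.range (HigmanThompson.localAction h)).Finite ∧
        h ∈ HigmanThompson.rationalGroup n r := fun h hG =>
    have hfin := HigmanThompson.finite_range_localAction hG
    ⟨hfin, HigmanThompson.mem_rationalGroup h hfin⟩
  refine ⟨main, fun φ h hφ => main h fun g hg => ?_⟩
  rw [← hφ ⟨g, hg⟩]
  exact (φ ⟨g, hg⟩).2
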